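/- Fix integers $m,n,k\ge 0$ with $k\ge m$. A partition is identified with its diagram, the set of cells $(i,j)$ (row $i$, column $j$) with $j\le\lambda_i$; it is $k$-bounded if its largest part is at most $k$. For a skew shape $\gamma/\rho$ (with $\rho\subseteq\gamma$ partitions) and a square $s=(i,j)\in\gamma$, the hook-length of $s$ is the number of cells of $\gamma/\rho$ lying in row $i$ weakly right of $s$ or in column $j$ in a row of index at least $i$. The $k$-skew diagram of a $k$-bounded partition $\lambda$ is the (unique) skew shape $\gamma/\rho$ whose $i$-th row has $\lambda_i$ cells for all $i$, all of whose cells have hook-length at most $k$, and such that every square of $\rho$ has hook-length greater than $k$. The $k$-conjugate $\lambda^{\omega_k}$ is the $k$-bounded partition whose parts are the column lengths of the $k$-skew diagram of $\lambda$. The order $\preceq$ on $k$-bounded partitions is the reflexive transitive closure of the relation $\lambda\prec\!\!\cdot\,\mu$ defined by: $\lambda\subseteq\mu$, $\lambda^{\omega_k}\subseteq\mu^{\omega_k}$ and $|\mu|=|\lambda|+1$. Let $L^k(m,n)=\{\mu:\mu\preceq (m^n)\}$, ordered by $\preceq$, where $(m^n)$ is the partition with $n$ parts equal to $m$. Theorem.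 Let $k\ge m$. (1) $L^k(m,n)$ is closed under intersection and union of diagrams, and it is a distributive lattice under $\preceq$ in which $\lambda\wedge\mu$ is the partition with diagram $\lambda\cap\mu$ and $\lambda\vee\mu$ is the partition with diagram $\lambda\cup\mu$. (2) The map $\lambda\mapsto\lambda^c$, where $\lambda^c$ is the complement of $\lambda$ in the box $(m^n)$ rotated by $180^\circ$, is an order-reversing bijection of $L^k(m,n)$ onto itself whose inverse is also order-reversing; so $L^k(m,n)$ is self-dual. (3) $L^k(m,n)$ is a finite graded poset of rank $mn$ with rank function $\lambda\mapsto|\lambda|$, and it is rank-symmetric: for $0\le i\le mn$ it has as many elements of rank $i$ as of rank $mn-i$. -/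

import Mathlib

namespace KYoung

/-- A skew shape `outer / inner`: two nested Young diagrams.  Cells are pairs `(i, j)`
(row, column), numbered from `0`, row `0` being the longest row of a partition. -/
structure SkewShape where
  outer : YoungDiagram
  inner : YoungDiagram
  le : inner ≤ outer

namespace SkewShape

/-- The cells of the skew shape. -/
def cells (D : SkewShape) : Finset (ℕ × ℕ) := D.outer.cells \ D.inner.cells

/-- The number of cells in row `i`. -/
def rowLen (D : SkewShape) (i : ℕ) : ℕ := (D.cells.filter fun c => c.1 = i).card

/-- The number of cells in column `j`. -/
def colLen (D : SkewShape) (j : ℕ) : ℕ := (D.cells.filter fun c => c.2 = j).card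

/-- Hook-length of the square `s` of the outer diagram: the number of cells of the skew shape in
the L with corner `s`.  If `s` lies in the inner diagram, it is not itself counted. -/
def hookLength (D : SkewShape) (s : ℕ × ℕ) : ℕ :=
  (D.cells.filter fun c => (c.1 = s.1 ∧ s.2 ≤ c.2) ∨ (c.2 = s.2 ∧ s.1 ≤ c.1)).card

end SkewShape

/-- `D` is the `k`-skew diagram of the partition `p`. -/
structure IsKSkew (k : ℕ) (p : YoungDiagram) (D : SkewShape) : Prop where
  row_length : ∀ i, D.rowLen i = p.rowLen i
  hook_le : ∀ s ∈ D.cells, D.hookLength s ≤ k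
  hook_gt : ∀ s ∈ D.inner.cells, k < D.hookLength s

/-- The set `𝒫ᵏ` of `k`-bounded partitions: the first (largest) part is at most `k`. -/
@[ext] structure KPartition (k : ℕ) where
  diagram : YoungDiagram
  bounded : diagram.rowLen 0 ≤ k

variable {k : ℕ}

/-- `q` is the `k`-conjugate of `p`: its parts are the column lengths of the `k`-skew diagram
of `p`. -/
def IsKConjugate (p q : KPartition k) : Prop :=
  ∃ D : SkewShape, IsKSkew k p.diagram D ∧ ∀ j, q.diagram.rowLen j = D.colLen j

/-- The relation `p ≺· q`: both `p ⊆ q` and the same for the `k`-conjugates, the degrees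
differing by one. -/
def KCover (p q : KPartition k) : Prop :=
  p.diagram ≤ q.diagram ∧
  (∃ p' q' : KPartition k, IsKConjugate p p' ∧ IsKConjugate q q' ∧ p'.diagram ≤ q'.diagram) ∧
  q.diagram.card = p.diagram.card + 1

theorem le_of_reflTransGen {p q : KPartition k} (h : Relation.ReflTransGen KCover p q) :
    p.diagram ≤ q.diagram := by
  induction h with
  | refl => exact le_refl _
  | tail _ h ih => exact le_trans ih h.1

/-- The `k`-Young order `≼` on `k`-bounded partitions. -/
instance : PartialOrder (KPartition k) where
  le p q := Relation.ReflTransGen KCover p q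
  le_refl _ := Relation.ReflTransGen.refl
  le_trans _ _ _ h h' := Relation.ReflTransGen.trans h h'
  le_antisymm p q h h' := KPartition.ext (le_antisymm (le_of_reflTransGen h)
    (le_of_reflTransGen h'))

/-- The rectangular partition `(mⁿ)`: `n` rows of length `m`. -/
def rectDiagram (m n : ℕ) : YoungDiagram where
  cells := Finset.range n ×ˢ Finset.range m
  isLowerSet := by
    rintro ⟨a, b⟩ ⟨c, d⟩ h hab
    obtain ⟨h1, h2⟩ := Prod.mk_le_mk.mp h
    simp only [Finset.coe_product, Finset.coe_range, Set.mem_prod, Set.mem_Iio] at hab ⊢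
    omega

/-- The rectangle `(mⁿ)` as a `k`-bounded partition, for `m ≤ k`. -/
def rect (m n : ℕ) (h : m ≤ k) : KPartition k where
  diagram := rectDiagram m n
  bounded := by
    by_contra hlt
    rw [not_le, ← YoungDiagram.mem_iff_lt_rowLen] at hlt
    change (0, k) ∈ Finset.range n ×ˢ Finset.range m at hlt
    simp only [Finset.mem_product, Finset.mem_range] at hlt
    omega

/-- `Lᵏ(m, n)`: the principal order ideal generated by `(mⁿ)` in the `k`-Young order, with the
order induced by `≼`. -/
abbrev L (m n : ℕ) (h : m ≤ k) : Type := Set.Iic (rect m n h)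

/-- The diagram of an element of `Lᵏ(m, n)`. -/
def L.shape {m n : ℕ} {h : m ≤ k} (p : L m n h) : YoungDiagram := p.1.diagram

/-- The complement of `p` in the box with `n` rows of length `m`, rotated by 180 degrees. -/
def boxCompl (m n : ℕ) (p : YoungDiagram) : YoungDiagram where
  cells := (Finset.range n ×ˢ Finset.range m).filter
    fun c => (n - 1 - c.1, m - 1 - c.2) ∉ p.cells
  isLowerSet := by
    rintro ⟨a, b⟩ ⟨c, d⟩ h hab
    obtain ⟨h1, h2⟩ := Prod.mk_le_mk.mp h
    simp only [Finset.coe_filter, Finset.mem_product, Finset.mem_range, Set.mem_ofPred_eq]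
      at hab ⊢
    refine ⟨⟨by omega, by omega⟩, fun hc => hab.2 ?_⟩
    have hle : ((n - 1 - a, m - 1 - b) : ℕ × ℕ) ≤ (n - 1 - c, m - 1 - d) :=
      Prod.mk_le_mk.mpr ⟨by omega, by omega⟩
    exact p.isLowerSet hle hc

/-- `r` is the rank function of the poset `P`, which is graded of rank `N`. -/
structure IsRankFunction {P : Type*} [PartialOrder P] (r : P → ℕ) (N : ℕ) : Prop where
  min : ∀ x, IsMin x → r x = 0
  covBy : ∀ x y, x ⋖ y → r y = r x + 1
  max : ∀ x, IsMax x → r x = N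

end KYoung

/-!
Write `r = k - m + 1`.  The ideal `Lᵏ(m, n)` is identified with the set of partitions inside the
box `(mⁿ)` having at most `r` short rows, that is, nonempty rows of length less than `m`, ordered by
containment (`le_iff_of_fewShortRows`).  From that description everything is immediate: the
condition is stable under intersection, union and complementation in the box, and one can pass from
a smaller element to a larger one by adding cells one at a time (`FewShortRows.exists_add_cell`).

The description rests on two facts about `k`-skew diagrams.

* For a partition `p` inside the box, the first column of a `k`-skew diagram of `p` has length at
  most `r` exactly when `p` has at most `r` short rows (`IsKSkew.colLen_zero_le`,
  `IsKSkew.lt_colLen_zero`); both directions come from comparing one hook in that column with `k`.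
  Since the first part of the `k`-conjugate cannot decrease along `≺·`, the condition is inherited
  by everything below the rectangle.
* If `p` has at most `r` short rows, its `k`-skew diagram is explicit (`isKSkew_stairSkew`): row `i`
  occupies the columns from `o (i + r)` up to `o i`, where `o i = p i + p (i + r) + p (i + 2r) + ⋯`.
  Column `j` then has length `min r H`, with `H` the number of rows `i` with `j < o i`, and this
  number grows with `p`.  Hence containment of such partitions, with degrees differing by one,
  already gives `≺·`.
-/

namespace KYoung

/-! ### Young diagrams given by their row lengths -/

/-- The Young diagram whose row `i` has length `f i`, for an antitone `f` vanishing at `N`. -/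
def ofRows (f : ℕ → ℕ) (hf : Antitone f) (N : ℕ) : YoungDiagram where
  cells := (Finset.range N ×ˢ Finset.range (f 0)).filter fun c => c.2 < f c.1
  isLowerSet := by
    rintro ⟨a, b⟩ ⟨c, d⟩ h hab
    obtain ⟨h1, h2⟩ := Prod.mk_le_mk.mp h
    have := hf h1
    simp only [Finset.coe_filter, Finset.mem_product, Finset.mem_range, Set.mem_ofPred_eq]
      at hab ⊢
    omega

theorem mem_ofRows {f : ℕ → ℕ} (hf : Antitone f) {N : ℕ} (hN : f N = 0) {i j : ℕ} :
    (i, j) ∈ ofRows f hf N ↔ j < f i := by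
  rw [← YoungDiagram.mem_cells]
  simp only [ofRows, Finset.mem_filter, Finset.mem_product, Finset.mem_range]
  refine ⟨fun h => h.2, fun h => ⟨⟨?_, h.trans_le (hf (Nat.zero_le i))⟩, h⟩⟩
  by_contra hi
  have := hf (not_lt.mp hi)
  omega

theorem rowLen_ofRows {f : ℕ → ℕ} (hf : Antitone f) {N : ℕ} (hN : f N = 0) (i : ℕ) :
    (ofRows f hf N).rowLen i = f i :=
  eq_of_forall_lt_iff fun j => by rw [← YoungDiagram.mem_iff_lt_rowLen, mem_ofRows hf hN]

theorem rowLen_le_rowLen {p q : YoungDiagram} (h : p ≤ q) (i : ℕ) : p.rowLen i ≤ q.rowLen i :=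
  le_of_forall_lt fun j hj => by
    rw [← YoungDiagram.mem_iff_lt_rowLen] at hj ⊢
    exact h hj

theorem le_of_rowLen_le {p q : YoungDiagram} (h : ∀ i, p.rowLen i ≤ q.rowLen i) : p ≤ q :=
  fun ⟨i, _⟩ hij => YoungDiagram.mem_iff_lt_rowLen.mpr
    ((YoungDiagram.mem_iff_lt_rowLen.mp hij).trans_le (h i))

theorem colLen_le_colLen {p q : YoungDiagram} (h : p ≤ q) (j : ℕ) : p.colLen j ≤ q.colLen j :=
  le_of_forall_lt fun i hi => by
    rw [← YoungDiagram.mem_iff_lt_colLen] at hi ⊢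
    exact h hi

theorem mem_rectDiagram {m n i j : ℕ} : (i, j) ∈ rectDiagram m n ↔ i < n ∧ j < m := by
  rw [← YoungDiagram.mem_cells]
  simp [rectDiagram]

theorem card_rectDiagram (m n : ℕ) : (rectDiagram m n).card = m * n := by
  change (Finset.range n ×ˢ Finset.range m).card = m * n
  simp [mul_comm]

theorem rowLen_le_of_le_rectDiagram {m n : ℕ} {p : YoungDiagram} (h : p ≤ rectDiagram m n)
    (i : ℕ) : p.rowLen i ≤ m := by
  by_contra! hlt
  rw [← YoungDiagram.mem_iff_lt_rowLen] at hlt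
  exact absurd (mem_rectDiagram.mp (h hlt)).2 (lt_irrefl m)

theorem rowLen_eq_zero_of_le_rectDiagram {m n : ℕ} {p : YoungDiagram} (h : p ≤ rectDiagram m n)
    {i : ℕ} (hi : n ≤ i) : p.rowLen i = 0 := by
  by_contra hne
  have := (mem_rectDiagram.mp (h (YoungDiagram.mem_iff_lt_rowLen.mpr (Nat.pos_of_ne_zero hne)))).1
  omega

/-! ### Lengths of rows, columns and hooks of a skew shape -/

namespace SkewShape

variable (D : SkewShape)

theorem mem_cells {i j : ℕ} :
    (i, j) ∈ D.cells ↔ D.inner.rowLen i ≤ j ∧ j < D.outer.rowLen i := by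
  rw [cells, Finset.mem_sdiff, YoungDiagram.mem_cells, YoungDiagram.mem_cells,
    YoungDiagram.mem_iff_lt_rowLen, YoungDiagram.mem_iff_lt_rowLen, not_lt, and_comm]

theorem mem_cells_col {i j : ℕ} :
    (i, j) ∈ D.cells ↔ D.inner.colLen j ≤ i ∧ i < D.outer.colLen j := by
  rw [cells, Finset.mem_sdiff, YoungDiagram.mem_cells, YoungDiagram.mem_cells,
    YoungDiagram.mem_iff_lt_colLen, YoungDiagram.mem_iff_lt_colLen, not_lt, and_comm]

theorem card_row_from (i j : ℕ) :
    (D.cells.filter fun c => c.1 = i ∧ j ≤ c.2).card =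
      D.outer.rowLen i - max j (D.inner.rowLen i) := by
  have : (D.cells.filter fun c => c.1 = i ∧ j ≤ c.2) =
      (Finset.Ico (max j (D.inner.rowLen i)) (D.outer.rowLen i)).map
        ⟨Prod.mk i, Prod.mk_right_injective i⟩ := by
    ext ⟨a, b⟩
    simp only [Finset.mem_filter, mem_cells, Finset.mem_map, Finset.mem_Ico,
      Function.Embedding.coeFn_mk, Prod.mk.injEq]
    constructor
    · rintro ⟨h, rfl, h'⟩
      exact ⟨b, by omega, rfl, rfl⟩
    · rintro ⟨b, h, rfl, rfl⟩
      exact ⟨by omega, rfl, by omega⟩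
  rw [this, Finset.card_map, Nat.card_Ico]

theorem card_col_from (i j : ℕ) :
    (D.cells.filter fun c => c.2 = j ∧ i ≤ c.1).card =
      D.outer.colLen j - max i (D.inner.colLen j) := by
  have : (D.cells.filter fun c => c.2 = j ∧ i ≤ c.1) =
      (Finset.Ico (max i (D.inner.colLen j)) (D.outer.colLen j)).map
        ⟨fun a => (a, j), Prod.mk_left_injective j⟩ := by
    ext ⟨a, b⟩
    simp only [Finset.mem_filter, mem_cells_col, Finset.mem_map, Finset.mem_Ico,
      Function.Embedding.coeFn_mk, Prod.mk.injEq]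
    constructor
    · rintro ⟨h, rfl, h'⟩
      exact ⟨a, by omega, rfl, rfl⟩
    · rintro ⟨a, h, rfl, rfl⟩
      exact ⟨by omega, rfl, by omega⟩
  rw [this, Finset.card_map, Nat.card_Ico]

theorem rowLen_eq (i : ℕ) : D.rowLen i = D.outer.rowLen i - D.inner.rowLen i := by
  simpa [rowLen] using D.card_row_from i 0

theorem colLen_eq (j : ℕ) : D.colLen j = D.outer.colLen j - D.inner.colLen j := by
  simpa [colLen] using D.card_col_from 0 j

theorem hookLength_eq (i j : ℕ) :
    D.hookLength (i, j) = (D.outer.rowLen i - max j (D.inner.rowLen i)) +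
      (D.outer.colLen j - max (i + 1) (D.inner.colLen j)) := by
  rw [← card_row_from, ← card_col_from, hookLength, ← Finset.card_union_of_disjoint]
  · congr 1
    ext ⟨a, b⟩
    simp only [Finset.mem_filter, Finset.mem_union, ← and_or_left]
    refine and_congr_right fun _ => ?_
    omega
  · refine Finset.disjoint_filter.mpr ?_
    rintro ⟨a, b⟩ _ h h'
    simp only at h h'
    omega

end SkewShape

/-! ### Partitions with few short rows -/

/-- The partitions inside the box `(mⁿ)` having at most `k - m + 1` nonempty rows of length less
than `m`.  This is expressed by saying that a row is full as soon as the row `k - m + 1` further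
down is nonempty. -/
def FewShortRows (k m n : ℕ) (p : YoungDiagram) : Prop :=
  p ≤ rectDiagram m n ∧ ∀ i j, (i + (k - m + 1), 0) ∈ p → j < m → (i, j) ∈ p

variable {k m n : ℕ}

theorem fewShortRows_rectDiagram : FewShortRows k m n (rectDiagram m n) := by
  refine ⟨le_rfl, fun i j h hj => ?_⟩
  rw [mem_rectDiagram] at h ⊢
  omega

theorem fewShortRows_bot : FewShortRows k m n ⊥ :=
  ⟨bot_le, fun _ _ h => absurd h (YoungDiagram.notMem_bot _)⟩

theorem FewShortRows.inf {p q : YoungDiagram} (hp : FewShortRows k m n p)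
    (hq : FewShortRows k m n q) : FewShortRows k m n (p ⊓ q) := by
  refine ⟨inf_le_left.trans hp.1, fun i j h hj => ?_⟩
  rw [YoungDiagram.mem_inf] at h ⊢
  exact ⟨hp.2 i j h.1 hj, hq.2 i j h.2 hj⟩

theorem FewShortRows.sup {p q : YoungDiagram} (hp : FewShortRows k m n p)
    (hq : FewShortRows k m n q) : FewShortRows k m n (p ⊔ q) := by
  refine ⟨sup_le hp.1 hq.1, fun i j h hj => ?_⟩
  rw [YoungDiagram.mem_sup] at h ⊢
  exact h.imp (fun h => hp.2 i j h hj) (fun h => hq.2 i j h hj)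

theorem FewShortRows.rowLen_eq {p : YoungDiagram} (hp : FewShortRows k m n p) {i : ℕ}
    (h : 0 < p.rowLen (i + (k - m + 1))) : p.rowLen i = m := by
  refine le_antisymm (rowLen_le_of_le_rectDiagram hp.1 i) (le_of_forall_lt fun j hj => ?_)
  rw [← YoungDiagram.mem_iff_lt_rowLen] at h ⊢
  exact hp.2 i j h hj

theorem FewShortRows.bounded (hmk : m ≤ k) {p : YoungDiagram} (hp : FewShortRows k m n p) :
    p.rowLen 0 ≤ k :=
  (rowLen_le_of_le_rectDiagram hp.1 0).trans hmk

/-! ### The first column of a `k`-skew diagram -/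

/-- With few short rows, the first column of a `k`-skew diagram has length at most `k - m + 1`:
otherwise its top cell would lie in a full row and its hook would be longer than `k`. -/
theorem IsKSkew.colLen_zero_le (hmk : m ≤ k) {p : YoungDiagram} (hp : FewShortRows k m n p)
    {D : SkewShape} (hD : IsKSkew k p D) : D.colLen 0 ≤ k - m + 1 := by
  by_contra! hlt
  rw [D.colLen_eq] at hlt
  set i := D.inner.colLen 0 with hi
  have hlow : (i + (k - m + 1), 0) ∈ D.cells := D.mem_cells_col.mpr (by omega)
  have htop : (i, 0) ∈ D.cells := D.mem_cells_col.mpr (by omega)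
  have hhook := hD.hook_le _ htop
  have hrow := hD.row_length i
  have hrow' := hD.row_length (i + (k - m + 1))
  rw [D.hookLength_eq] at hhook
  rw [D.rowLen_eq] at hrow hrow'
  rw [D.mem_cells] at hlow htop
  have hfull := hp.rowLen_eq (i := i) (by omega)
  omega

/-- With too many short rows, the first column of a `k`-skew diagram is longer than `k - m + 1`.
Consider a short row with a nonempty row `k - m + 1` further down.  If it starts in the first
column, so do all rows below it; otherwise the hook at its first square, which lies in the inner
diagram, has length greater than `k`, so that the first column must be long. -/
theorem IsKSkew.lt_colLen_zero (hmk : m ≤ k) {p : YoungDiagram} (hp : p ≤ rectDiagram m n)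
    (hp' : ¬ FewShortRows k m n p) {D : SkewShape} (hD : IsKSkew k p D) :
    k - m + 1 < D.colLen 0 := by
  simp only [FewShortRows, hp, true_and, not_forall] at hp'
  obtain ⟨i, j, hlow, hj, hij⟩ := hp'
  rw [YoungDiagram.mem_iff_lt_rowLen] at hlow hij
  rw [D.colLen_eq]
  have hrow := hD.row_length i
  have hrow' := hD.row_length (i + (k - m + 1))
  rw [D.rowLen_eq] at hrow hrow'
  by_cases hin : (i, 0) ∈ D.inner
  · have hhook := hD.hook_gt _ ((YoungDiagram.mem_cells _).mpr hin)
    rw [D.hookLength_eq] at hhook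
    rw [YoungDiagram.mem_iff_lt_colLen] at hin
    omega
  · have hout : (i + (k - m + 1), 0) ∈ D.outer := YoungDiagram.mem_iff_lt_rowLen.mpr (by omega)
    rw [YoungDiagram.mem_iff_lt_colLen] at hin hout
    omega

theorem FewShortRows.of_kCover (hmk : m ≤ k) {p q : KPartition k} (h : KCover p q)
    (hq : FewShortRows k m n q.diagram) : FewShortRows k m n p.diagram := by
  obtain ⟨hle, ⟨p', q', ⟨D, hD, hp'⟩, ⟨E, hE, hq'⟩, hle'⟩, -⟩ := h
  by_contra hp
  have h1 := hD.lt_colLen_zero hmk (hle.trans hq.1) hp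
  have h2 := hE.colLen_zero_le hmk hq
  have h3 := rowLen_le_rowLen hle' 0
  rw [hp', hq'] at h3
  omega

theorem FewShortRows.of_le (hmk : m ≤ k) {p q : KPartition k} (h : p ≤ q)
    (hq : FewShortRows k m n q.diagram) : FewShortRows k m n p.diagram := by
  change Relation.ReflTransGen KCover p q at h
  induction h with
  | refl => exact hq
  | tail _ h ih => exact ih (hq.of_kCover hmk h)

/-! ### The `k`-skew diagram of a partition with few short rows -/

/-- The sum of the lengths of the rows `i`, `i + r`, `i + 2r`, … of `p`.  The rows of `p` from `n`
on are meant to be empty, so `n` terms suffice. -/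
def stairRow (r n : ℕ) (p : YoungDiagram) (i : ℕ) : ℕ :=
  ∑ t ∈ Finset.range n, p.rowLen (i + t * r)

theorem stairRow_antitone (r n : ℕ) (p : YoungDiagram) : Antitone (stairRow r n p) :=
  fun _ _ h => Finset.sum_le_sum fun _ _ => p.rowLen_anti _ _ (by omega)

theorem stairRow_mono (r n : ℕ) {p q : YoungDiagram} (h : p ≤ q) (i : ℕ) :
    stairRow r n p i ≤ stairRow r n q i :=
  Finset.sum_le_sum fun _ _ => rowLen_le_rowLen h _

theorem stairRow_eq_zero {r n : ℕ} {p : YoungDiagram} {i : ℕ} (hi : p.rowLen i = 0) :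
    stairRow r n p i = 0 :=
  Finset.sum_eq_zero fun t _ =>
    Nat.eq_zero_of_le_zero ((p.rowLen_anti i (i + t * r) (by omega)).trans hi.le)

theorem stairRow_eq_add {r : ℕ} (hr : 0 < r) {p : YoungDiagram} (hp : p ≤ rectDiagram m n)
    (i : ℕ) : stairRow r n p i = p.rowLen i + stairRow r n p (i + r) := by
  have hlast : p.rowLen (i + n * r) = 0 :=
    rowLen_eq_zero_of_le_rectDiagram hp ((Nat.le_mul_of_pos_right n hr).trans (by omega))
  have h1 := Finset.sum_range_succ (fun t => p.rowLen (i + t * r)) n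
  have h2 := Finset.sum_range_succ' (fun t => p.rowLen (i + t * r)) n
  have h3 : stairRow r n p (i + r) = ∑ t ∈ Finset.range n, p.rowLen (i + (t + 1) * r) :=
    Finset.sum_congr rfl fun t _ => by
      rw [add_one_mul, add_right_comm, add_assoc i]
  rw [h3]
  simp only [hlast, zero_mul, add_zero] at h1 h2
  rw [stairRow]
  omega

/-- The skew shape whose rows are the rows of `p`, row `i` starting where row `i + r` ends. -/
def stairSkew (r n : ℕ) (p : YoungDiagram) : SkewShape where
  outer := ofRows (stairRow r n p) (stairRow_antitone r n p) n
  inner := ofRows (fun i => stairRow r n p (i + r))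
    (fun _ _ h => stairRow_antitone r n p (Nat.add_le_add_right h r)) n
  le := by
    rintro ⟨i, j⟩ h
    simp only [← YoungDiagram.mem_cells, ofRows, Finset.mem_filter, Finset.mem_product,
      Finset.mem_range] at h ⊢
    have h1 := stairRow_antitone r n p (Nat.le_add_right i r)
    have h2 := stairRow_antitone r n p (Nat.le_add_right 0 r)
    omega

theorem rowLen_outer_stairSkew {p : YoungDiagram} (hp : p ≤ rectDiagram m n) (r i : ℕ) :
    (stairSkew r n p).outer.rowLen i = stairRow r n p i :=
  rowLen_ofRows (stairRow_antitone r n p)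
    (stairRow_eq_zero (rowLen_eq_zero_of_le_rectDiagram hp le_rfl)) i

theorem rowLen_inner_stairSkew {p : YoungDiagram} (hp : p ≤ rectDiagram m n) (r i : ℕ) :
    (stairSkew r n p).inner.rowLen i = stairRow r n p (i + r) :=
  rowLen_ofRows (fun _ _ h => stairRow_antitone r n p (Nat.add_le_add_right h r))
    (stairRow_eq_zero (rowLen_eq_zero_of_le_rectDiagram hp (Nat.le_add_right n r))) i

theorem colLen_inner_stairSkew {p : YoungDiagram} (hp : p ≤ rectDiagram m n) (r j : ℕ) :
    (stairSkew r n p).inner.colLen j = (stairSkew r n p).outer.colLen j - r :=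
  eq_of_forall_lt_iff fun i => by
    rw [← YoungDiagram.mem_iff_lt_colLen, YoungDiagram.mem_iff_lt_rowLen,
      rowLen_inner_stairSkew hp, ← rowLen_outer_stairSkew hp, ← YoungDiagram.mem_iff_lt_rowLen,
      YoungDiagram.mem_iff_lt_colLen, Nat.lt_sub_iff_add_lt]

theorem colLen_stairSkew {p : YoungDiagram} (hp : p ≤ rectDiagram m n) (r j : ℕ) :
    (stairSkew r n p).colLen j = min r ((stairSkew r n p).outer.colLen j) := by
  rw [SkewShape.colLen_eq, colLen_inner_stairSkew hp]
  omega

theorem colLen_outer_stairSkew_mono {p q : YoungDiagram} (hq : q ≤ rectDiagram m n) (h : p ≤ q)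
    (r j : ℕ) : (stairSkew r n p).outer.colLen j ≤ (stairSkew r n q).outer.colLen j :=
  colLen_le_colLen (le_of_rowLen_le fun i => by
    rw [rowLen_outer_stairSkew (h.trans hq), rowLen_outer_stairSkew hq]
    exact stairRow_mono r n h i) j

/-- A cell of row `i` has fewer than `r` cells below it, which bounds its hook by
`m + (r - 1) = k`.  A square of the inner diagram in row `i` has exactly `r` cells of the skew shape
below it, and row `i` is full since row `i + r` is nonempty; so its hook-length is
`m + r = k + 1`. -/
theorem isKSkew_stairSkew (hmk : m ≤ k) {p : YoungDiagram} (hp : FewShortRows k m n p) :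
    IsKSkew k p (stairSkew (k - m + 1) n p) := by
  set r := k - m + 1 with hr
  have hadd := stairRow_eq_add (r := r) (by omega) hp.1
  refine ⟨fun i => ?_, ?_, ?_⟩
  · rw [SkewShape.rowLen_eq, rowLen_outer_stairSkew hp.1, rowLen_inner_stairSkew hp.1, hadd i]
    omega
  · rintro ⟨i, j⟩ hs
    have hm := rowLen_le_of_le_rectDiagram hp.1 i
    rw [SkewShape.hookLength_eq, colLen_inner_stairSkew hp.1, rowLen_outer_stairSkew hp.1,
      rowLen_inner_stairSkew hp.1, hadd i]
    rw [SkewShape.mem_cells_col, colLen_inner_stairSkew hp.1] at hs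
    omega
  · rintro ⟨i, j⟩ hs
    rw [YoungDiagram.mem_cells] at hs
    have hs' := hs
    rw [YoungDiagram.mem_iff_lt_rowLen, rowLen_inner_stairSkew hp.1] at hs
    rw [YoungDiagram.mem_iff_lt_colLen, colLen_inner_stairSkew hp.1] at hs'
    have hpos : 0 < p.rowLen (i + r) := by
      by_contra h
      rw [stairRow_eq_zero (by omega)] at hs
      omega
    have hfull := hp.rowLen_eq hpos
    rw [SkewShape.hookLength_eq, colLen_inner_stairSkew hp.1, rowLen_outer_stairSkew hp.1,
      rowLen_inner_stairSkew hp.1, hadd i]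
    omega

/-- The partition whose parts are the column lengths `min r H` of `stairSkew r n p`, where `H` runs
over the column lengths of its outer diagram. -/
def stairConj (r n : ℕ) (p : YoungDiagram) : YoungDiagram :=
  ofRows (fun j => min r ((stairSkew r n p).outer.colLen j))
    (fun _ _ h => min_le_min_left r ((stairSkew r n p).outer.colLen_anti _ _ h))
    (stairRow r n p 0)

theorem rowLen_stairConj {p : YoungDiagram} (hp : p ≤ rectDiagram m n) (r j : ℕ) :
    (stairConj r n p).rowLen j = (stairSkew r n p).colLen j := by
  rw [colLen_stairSkew hp]
  refine rowLen_ofRows _ ?_ j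
  rw [Nat.min_eq_zero_iff]
  right
  by_contra h
  have h' := YoungDiagram.mem_iff_lt_colLen.mpr (Nat.pos_of_ne_zero h)
  rw [YoungDiagram.mem_iff_lt_rowLen, rowLen_outer_stairSkew hp] at h'
  exact lt_irrefl _ h'

theorem rowLen_stairConj_zero_le (hmk : m ≤ k) {p : YoungDiagram} (hp : FewShortRows k m n p) :
    (stairConj (k - m + 1) n p).rowLen 0 ≤ k := by
  rw [rowLen_stairConj hp.1]
  by_contra! h
  -- The first column is nonempty, so some row is, and hence `m > 0` and `k - m + 1 ≤ k`.
  have hle := (isKSkew_stairSkew hmk hp).colLen_zero_le hmk hp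
  rw [SkewShape.colLen_eq] at h hle
  set D := stairSkew (k - m + 1) n p with hD
  have hc : (D.inner.colLen 0, 0) ∈ D.cells := D.mem_cells_col.mpr (by omega)
  have hrow := (isKSkew_stairSkew hmk hp).row_length (D.inner.colLen 0)
  have hm := rowLen_le_of_le_rectDiagram hp.1 (D.inner.colLen 0)
  rw [← hD, D.rowLen_eq] at hrow
  rw [D.mem_cells] at hc
  omega

/-! ### The `k`-Young order below the rectangle -/

theorem kCover_of_fewShortRows (hmk : m ≤ k) {p q : KPartition k}
    (hp : FewShortRows k m n p.diagram) (hq : FewShortRows k m n q.diagram)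
    (hle : p.diagram ≤ q.diagram) (hcard : q.diagram.card = p.diagram.card + 1) : KCover p q := by
  refine ⟨hle, ⟨⟨stairConj (k - m + 1) n p.diagram, rowLen_stairConj_zero_le hmk hp⟩,
    ⟨stairConj (k - m + 1) n q.diagram, rowLen_stairConj_zero_le hmk hq⟩,
    ⟨_, isKSkew_stairSkew hmk hp, rowLen_stairConj hp.1 _⟩,
    ⟨_, isKSkew_stairSkew hmk hq, rowLen_stairConj hq.1 _⟩,
    le_of_rowLen_le fun j => ?_⟩, hcard⟩
  rw [rowLen_stairConj hp.1, rowLen_stairConj hq.1, colLen_stairSkew hp.1, colLen_stairSkew hq.1]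
  exact min_le_min_left _ (colLen_outer_stairSkew_mono hq.1 hle _ j)

/-- The partition obtained from `p` by adding a cell at the end of the first row in which `p`
and `q` differ has few short rows if `p` and `q` do: when that row is empty in `p`, the row
`k - m + 1` further up is full in `q`, hence in `p`. -/
theorem FewShortRows.exists_add_cell {p q : YoungDiagram} (hp : FewShortRows k m n p)
    (hq : FewShortRows k m n q) (hle : p ≤ q) (hne : p ≠ q) :
    ∃ s, FewShortRows k m n s ∧ p ≤ s ∧ s ≤ q ∧ s.card = p.card + 1 := by
  have hex : ∃ i, p.rowLen i < q.rowLen i := by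
    by_contra! h
    exact hne (le_antisymm hle (le_of_rowLen_le h))
  classical
  set i := Nat.find hex with hi
  have hlt : p.rowLen i < q.rowLen i := Nat.find_spec hex
  have heq : ∀ a < i, q.rowLen a ≤ p.rowLen a := fun a ha => not_lt.mp (Nat.find_min hex ha)
  have hnew : (i, p.rowLen i) ∈ q := YoungDiagram.mem_iff_lt_rowLen.mpr hlt
  let s : YoungDiagram :=
    { cells := insert (i, p.rowLen i) p.cells
      isLowerSet := by
        rintro ⟨a, b⟩ ⟨c, d⟩ h hab
        obtain ⟨h1, h2⟩ := Prod.mk_le_mk.mp h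
        simp only [Finset.coe_insert, Set.mem_insert_iff, SetLike.mem_coe, YoungDiagram.mem_cells,
          YoungDiagram.mem_iff_lt_rowLen, Prod.mk.injEq] at hab ⊢
        rcases hab with ⟨rfl, rfl⟩ | hab
        · rcases h1.lt_or_eq with hc | rfl
          · have := heq c hc
            have := q.rowLen_anti _ _ h1
            omega
          · omega
        · have := p.rowLen_anti _ _ h1
          omega }
  have hs : ∀ c, c ∈ s ↔ c = (i, p.rowLen i) ∨ c ∈ p := fun c => by
    rw [← YoungDiagram.mem_cells, ← YoungDiagram.mem_cells]
    exact Finset.mem_insert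
  have hsq : s ≤ q := fun c hc => by
    rcases (hs c).mp hc with rfl | hc
    exacts [hnew, hle hc]
  refine ⟨s, ⟨hsq.trans hq.1, fun a b ha hb => ?_⟩, fun c hc => (hs c).mpr (Or.inr hc), hsq, ?_⟩
  · refine (hs _).mpr (Or.inr ?_)
    rcases (hs _).mp ha with ha' | ha'
    · have hqa := hq.2 a b (hsq ha) hb
      rw [Prod.mk.injEq] at ha'
      rw [YoungDiagram.mem_iff_lt_rowLen] at hqa ⊢
      exact hqa.trans_le (heq a (by omega))
    · exact hp.2 a b ha' hb
  · refine Finset.card_insert_of_notMem ?_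
    rw [YoungDiagram.mem_cells, YoungDiagram.mem_iff_lt_rowLen]
    exact lt_irrefl _

theorem le_of_fewShortRows (hmk : m ≤ k) {p q : KPartition k}
    (hp : FewShortRows k m n p.diagram) (hq : FewShortRows k m n q.diagram)
    (hle : p.diagram ≤ q.diagram) : p ≤ q := by
  induction hd : q.diagram.card - p.diagram.card generalizing p with
  | zero =>
    refine le_of_eq (KPartition.ext (YoungDiagram.ext (Finset.eq_of_subset_of_card_le hle ?_)))
    exact Nat.sub_eq_zero_iff_le.mp hd
  | succ d ih =>
    have hne : p.diagram ≠ q.diagram := fun h => by simp [h] at hd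
    obtain ⟨s, hs, hps, hsq, hcard⟩ := hp.exists_add_cell hq hle hne
    exact Relation.ReflTransGen.head
      (kCover_of_fewShortRows hmk (q := ⟨s, hs.bounded hmk⟩) hp hs hps hcard)
      (ih hs hsq (by simp only [hcard]; omega))

/-- Below a partition with few short rows, the `k`-Young order is containment of partitions with
few short rows. -/
theorem le_iff_of_fewShortRows (hmk : m ≤ k) {p q : KPartition k}
    (hq : FewShortRows k m n q.diagram) :
    p ≤ q ↔ FewShortRows k m n p.diagram ∧ p.diagram ≤ q.diagram :=
  ⟨fun h => ⟨hq.of_le hmk h, le_of_reflTransGen h⟩, fun h => le_of_fewShortRows hmk h.1 hq h.2⟩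

/-! ### Complementation in the box -/

theorem mem_boxCompl {p : YoungDiagram} {i j : ℕ} :
    (i, j) ∈ boxCompl m n p ↔ (i < n ∧ j < m) ∧ (n - 1 - i, m - 1 - j) ∉ p := by
  rw [← YoungDiagram.mem_cells]
  simp [boxCompl]

theorem boxCompl_boxCompl {p : YoungDiagram} (hp : p ≤ rectDiagram m n) :
    boxCompl m n (boxCompl m n p) = p := by
  ext ⟨i, j⟩
  rw [YoungDiagram.mem_cells, YoungDiagram.mem_cells, mem_boxCompl, mem_boxCompl]
  constructor
  · rintro ⟨⟨h1, h2⟩, h⟩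
    rw [show n - 1 - (n - 1 - i) = i by omega, show m - 1 - (m - 1 - j) = j by omega] at h
    by_contra hij
    exact h ⟨by omega, hij⟩
  · intro h
    obtain ⟨h1, h2⟩ := mem_rectDiagram.mp (hp h)
    refine ⟨⟨h1, h2⟩, fun h' => h'.2 ?_⟩
    rwa [show n - 1 - (n - 1 - i) = i by omega, show m - 1 - (m - 1 - j) = j by omega]

theorem boxCompl_anti {p q : YoungDiagram} (h : p ≤ q) : boxCompl m n q ≤ boxCompl m n p :=
  fun ⟨_, _⟩ hij => mem_boxCompl.mpr ((mem_boxCompl.mp hij).imp_right fun hn hp => hn (h hp))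

theorem card_boxCompl {p : YoungDiagram} (hp : p ≤ rectDiagram m n) :
    (boxCompl m n p).card = m * n - p.card := by
  have hrot : (boxCompl m n p).card = ((rectDiagram m n).cells \ p.cells).card := by
    refine Finset.card_nbij' (fun c => (n - 1 - c.1, m - 1 - c.2))
      (fun c => (n - 1 - c.1, m - 1 - c.2)) ?_ ?_ ?_ ?_
    · rintro ⟨i, j⟩ h
      obtain ⟨h1, h2⟩ := mem_boxCompl.mp h
      exact Finset.mem_coe.mpr (Finset.mem_sdiff.mpr
        ⟨mem_rectDiagram.mpr ⟨by omega, by omega⟩, h2⟩)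
    · rintro ⟨i, j⟩ h
      obtain ⟨h1, h2⟩ := Finset.mem_sdiff.mp (Finset.mem_coe.mp h)
      obtain ⟨h3, h4⟩ := mem_rectDiagram.mp h1
      refine mem_boxCompl.mpr ⟨⟨by omega, by omega⟩, ?_⟩
      rwa [show n - 1 - (n - 1 - i) = i by omega, show m - 1 - (m - 1 - j) = j by omega]
    · rintro ⟨i, j⟩ h
      have := (mem_boxCompl.mp h).1
      simp only [Prod.mk.injEq]
      omega
    · rintro ⟨i, j⟩ h
      have := mem_rectDiagram.mp (Finset.mem_sdiff.mp (Finset.mem_coe.mp h)).1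
      simp only [Prod.mk.injEq]
      omega
  rw [hrot, Finset.card_sdiff_of_subset hp]
  exact congrArg (· - p.card) (card_rectDiagram m n)

theorem FewShortRows.boxCompl {p : YoungDiagram} (hp : FewShortRows k m n p) :
    FewShortRows k m n (boxCompl m n p) := by
  refine ⟨fun ⟨i, j⟩ h => mem_rectDiagram.mpr (mem_boxCompl.mp h).1, fun i j h hj => ?_⟩
  obtain ⟨h1, h2⟩ := mem_boxCompl.mp h
  refine mem_boxCompl.mpr ⟨⟨by omega, hj⟩, fun hij => h2 (hp.2 _ _ ?_ (by omega))⟩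
  refine p.isLowerSet (Prod.mk_le_mk.mpr ⟨?_, Nat.zero_le _⟩) hij
  omega

/-! ### The ideal generated by the rectangle -/

namespace L

variable {hmk : m ≤ k}

theorem fewShortRows (p : L m n hmk) : FewShortRows k m n p.shape :=
  FewShortRows.of_le hmk (q := rect m n hmk) p.2 fewShortRows_rectDiagram

/-- The element of `Lᵏ(m, n)` given by a diagram with few short rows. -/
def ofShape (hmk : m ≤ k) (p : YoungDiagram) (hp : FewShortRows k m n p) : L m n hmk :=
  ⟨⟨p, hp.bounded hmk⟩, le_of_fewShortRows hmk hp fewShortRows_rectDiagram hp.1⟩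

theorem shape_injective : Function.Injective (shape : L m n hmk → YoungDiagram) :=
  fun _ _ h => Subtype.ext (KPartition.ext h)

theorem le_iff {p q : L m n hmk} : p ≤ q ↔ p.shape ≤ q.shape :=
  (le_iff_of_fewShortRows hmk q.fewShortRows).trans (and_iff_right p.fewShortRows)

/-- Meet and join in `Lᵏ(m, n)` are intersection and union of diagrams. -/
abbrev distribLattice : DistribLattice (L m n hmk) where
  toPartialOrder := inferInstance
  inf p q := ofShape hmk _ (p.fewShortRows.inf q.fewShortRows)
  sup p q := ofShape hmk _ (p.fewShortRows.sup q.fewShortRows)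
  inf_le_left p q := le_iff.mpr (inf_le_left (a := p.shape) (b := q.shape))
  inf_le_right p q := le_iff.mpr (inf_le_right (a := p.shape) (b := q.shape))
  le_inf _ _ _ h h' := le_iff.mpr (le_inf (le_iff.mp h) (le_iff.mp h'))
  le_sup_left p q := le_iff.mpr (le_sup_left (a := p.shape) (b := q.shape))
  le_sup_right p q := le_iff.mpr (le_sup_right (a := p.shape) (b := q.shape))
  sup_le _ _ _ h h' := le_iff.mpr (sup_le (le_iff.mp h) (le_iff.mp h'))
  le_sup_inf p q r := le_iff.mpr (le_sup_inf (x := p.shape) (y := q.shape) (z := r.shape))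

/-- Complementation in the box is an anti-automorphism of `Lᵏ(m, n)`. -/
def compl : L m n hmk ≃o (L m n hmk)ᵒᵈ where
  toFun p := OrderDual.toDual (ofShape hmk _ p.fewShortRows.boxCompl)
  invFun p := ofShape hmk _ (OrderDual.ofDual p).fewShortRows.boxCompl
  left_inv p := shape_injective (boxCompl_boxCompl p.fewShortRows.1)
  right_inv p := shape_injective (boxCompl_boxCompl (OrderDual.ofDual p).fewShortRows.1)
  map_rel_iff' {p q} := by
    refine le_iff.trans (Iff.trans ⟨fun h => ?_, fun h => boxCompl_anti h⟩ le_iff.symm)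
    rw [← boxCompl_boxCompl p.fewShortRows.1, ← boxCompl_boxCompl q.fewShortRows.1]
    exact boxCompl_anti h

theorem shape_compl (p : L m n hmk) :
    (OrderDual.ofDual (compl p)).shape = KYoung.boxCompl m n p.shape :=
  rfl

theorem card_shape_compl (p : L m n hmk) :
    (OrderDual.ofDual (compl p)).shape.card = m * n - p.shape.card :=
  card_boxCompl p.fewShortRows.1

theorem finite : Finite (L m n hmk) := by
  refine Finite.of_injective (fun p : L m n hmk =>
    (⟨p.shape.cells, Finset.mem_powerset.mpr p.fewShortRows.1⟩ :
      (rectDiagram m n).cells.powerset)) fun p q h => ?_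
  exact shape_injective (YoungDiagram.ext (congrArg Subtype.val h))

theorem isRankFunction_card :
    IsRankFunction (fun p : L m n hmk => p.shape.card) (m * n) where
  min p hp := by
    have h : p.shape ≤ ⊥ := le_iff.mp (hp (b := ofShape hmk ⊥ fewShortRows_bot)
      (le_iff.mpr (bot_le (a := p.shape))))
    simp [le_bot_iff.mp h]
  covBy p q h := by
    obtain ⟨s, hs, hps, hsq, hcard⟩ := p.fewShortRows.exists_add_cell q.fewShortRows
      (le_iff.mp h.le) (fun he => h.ne (shape_injective he))
    have hps' : p ≤ ofShape hmk s hs := le_iff.mpr hps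
    have hsq' : ofShape hmk s hs ≤ q := le_iff.mpr hsq
    rcases h.eq_or_eq hps' hsq' with he | he
    · have : s = p.shape := congrArg shape he
      rw [this] at hcard
      omega
    · have : s = q.shape := congrArg shape he
      rwa [this] at hcard
  max p hp := by
    have h : rectDiagram m n ≤ p.shape :=
      le_iff.mp (hp (b := ofShape hmk _ fewShortRows_rectDiagram) (le_iff.mpr p.fewShortRows.1))
    rw [le_antisymm p.fewShortRows.1 h, card_rectDiagram]

theorem ncard_card_eq {i : ℕ} (hi : i ≤ m * n) :
    {p : L m n hmk | p.shape.card = i}.ncard =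
      {p : L m n hmk | p.shape.card = m * n - i}.ncard := by
  refine Set.ncard_congr (fun p _ => OrderDual.ofDual (compl p)) ?_ ?_ ?_
  · rintro p rfl
    exact card_shape_compl p
  · exact fun p q _ _ h => compl.injective h
  · intro p hp
    refine ⟨compl.symm (OrderDual.toDual p), ?_, compl.apply_symm_apply _⟩
    have h := card_boxCompl p.fewShortRows.1
    rw [Set.mem_ofPred_eq] at hp ⊢
    change (KYoung.boxCompl m n p.shape).card = i
    omega

end L

end KYoung

theorem mainTheorem7 (k m n : ℕ) (hmk : m ≤ k) :
    -- closed under intersection and union of diagrams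
    (∀ p q : KYoung.L m n hmk,
      (∃ r : KYoung.L m n hmk, r.shape = p.shape ⊓ q.shape) ∧
      (∃ r : KYoung.L m n hmk, r.shape = p.shape ⊔ q.shape)) ∧
    -- a distributive lattice for the given order, meet and join being intersection and union
    (∃ D : DistribLattice (KYoung.L m n hmk),
      D.toPartialOrder = (inferInstance : PartialOrder (KYoung.L m n hmk)) ∧
      (∀ p q : KYoung.L m n hmk, (D.inf p q).shape = p.shape ⊓ q.shape) ∧
      (∀ p q : KYoung.L m n hmk, (D.sup p q).shape = p.shape ⊔ q.shape)) ∧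
    -- complementation in the box is an order-reversing bijection
    (∃ φ : KYoung.L m n hmk ≃o (KYoung.L m n hmk)ᵒᵈ,
      ∀ p, (OrderDual.ofDual (φ p)).shape = KYoung.boxCompl m n p.shape) ∧
    -- finite, graded of rank `m * n` by the degree, and rank-symmetric
    Finite (KYoung.L m n hmk) ∧
    KYoung.IsRankFunction (fun p : KYoung.L m n hmk => p.shape.card) (m * n) ∧
    (∀ i ≤ m * n, {p : KYoung.L m n hmk | p.shape.card = i}.ncard =
      {p : KYoung.L m n hmk | p.shape.card = m * n - i}.ncard) := by
  exact ⟨fun p q => ⟨⟨KYoung.L.distribLattice.inf p q, rfl⟩,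
    ⟨KYoung.L.distribLattice.sup p q, rfl⟩⟩,
    ⟨KYoung.L.distribLattice, rfl, fun _ _ => rfl, fun _ _ => rfl⟩,
    ⟨KYoung.L.compl, KYoung.L.shape_compl⟩, KYoung.L.finite, KYoung.L.isRankFunction_card,
    fun _ hi => KYoung.L.ncard_card_eq hi⟩
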